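/- Let $A$ be a unital Banach algebra over $\mathbb K=\mathbb R$ or $\mathbb C$ (with submultiplicative norm). All modules are unital left Banach $A$-modules with $\|a\cdot x\|\le\|a\|\,\|x\|$, and morphisms are continuous $A$-linear maps. A morphism $\psi\colon X_0\to X$ is called \emph{small} if every morphism $\varphi\colon Y\to X$ for which $Y\oplus X_0\to X$, $(y,z)\mapsto\varphi(y)+\psi(z)$, is surjective is itself surjective. A \emph{contractive monomorphism} is an injective morphism of norm at most $1$. A contractive monomorphism $\alpha\colon Y\to X$ is called \emph{maximal} if it is not surjective and, whenever $\alpha=\beta\kappa$ with $\beta$ a non-surjective contractive monomorphism and $\kappa$ a contractive morphism, $\kappa$ is an isometric isomorphism. The \emph{topological radical} $\operatorname{trad}X$ is the intersection of the ranges of all maximal contractive monomorphisms into $X$ (so $\operatorname{trad}X=X$ if there are none). Let $X$ be a (unital left) Banach $A$-module that is finitely generated, i.e. $X=A\cdot x_1+\dots+A\cdot x_n$ for some $x_1,\dots,x_n\in X$. Then $\operatorname{trad}X$ is a closed submodule of $X$, it equals the union of the ranges of all small morphisms into $X$, and the inclusion $\operatorname{trad}X\to X$ is a small morphism. -/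

import Mathlib

open Function

universe w k u v t

noncomputable section

/-- A morphism `ψ : X₀ → X` of left Banach `A`-modules (a continuous `A`-linear map) is small if a
morphism `φ : Y → X` from a Banach module `Y` is surjective as soon as
`Y ⊕ X₀ → X, (y, z) ↦ φ y + ψ z` is surjective. The test modules `Y` range over the universe `w`. -/
def IsSmallMorphism.{w', k', u', v', t'} (𝕜 : Type k') {A : Type u'} {X₀ : Type t'} {X : Type v'}
    [RCLike 𝕜] [NormedRing A] [NormedAlgebra 𝕜 A]
    [NormedAddCommGroup X₀] [Module A X₀] [NormedAddCommGroup X] [Module A X]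
    (ψ : X₀ →L[A] X) : Prop :=
  ∀ (Y : Type w') [NormedAddCommGroup Y] [NormedSpace 𝕜 Y] [CompleteSpace Y]
    [Module A Y] [IsScalarTower 𝕜 A Y] [IsBoundedSMul A Y] (φ : Y →L[A] X),
    Surjective (fun p : Y × X₀ => φ p.1 + ψ p.2) → Surjective φ

/-- A morphism of norm at most one. -/
def IsContractive {A : Type u} {Y : Type t} {X : Type v} [NormedRing A]
    [NormedAddCommGroup Y] [Module A Y] [NormedAddCommGroup X] [Module A X]
    (α : Y →L[A] X) : Prop :=
  ∀ y, ‖α y‖ ≤ ‖y‖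

/-- A contractive monomorphism: an injective morphism of norm at most one. -/
def IsContractiveMono {A : Type u} {Y : Type t} {X : Type v} [NormedRing A]
    [NormedAddCommGroup Y] [Module A Y] [NormedAddCommGroup X] [Module A X]
    (α : Y →L[A] X) : Prop :=
  Injective α ∧ IsContractive α

/-- A contractive monomorphism `α : Y → X` is maximal if it is not surjective and, whenever
`α = β ∘ κ` with `β : Z → X` a non-surjective contractive monomorphism of Banach modules and `κ`
a contractive morphism, `κ` is an isometric isomorphism. Modules that embed in `X` may be taken in
the universe of `X`. -/
def IsMaximalContractiveMono (𝕜 : Type k) {A : Type u} {Y X : Type v}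
    [RCLike 𝕜] [NormedRing A] [NormedAlgebra 𝕜 A]
    [NormedAddCommGroup Y] [Module A Y] [NormedAddCommGroup X] [Module A X]
    (α : Y →L[A] X) : Prop :=
  IsContractiveMono α ∧ ¬ Surjective α ∧
    ∀ (Z : Type v) [NormedAddCommGroup Z] [NormedSpace 𝕜 Z] [CompleteSpace Z]
      [Module A Z] [IsScalarTower 𝕜 A Z] [IsBoundedSMul A Z]
      (β : Z →L[A] X) (κ : Y →L[A] Z),
      IsContractiveMono β → ¬ Surjective β → IsContractive κ → α = β.comp κ →
        Isometry κ ∧ Surjective κ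

/-- The topological radical of `X`: the intersection of the ranges of all maximal contractive
monomorphisms of Banach modules into `X` (it is `X` itself if there are none). -/
def trad (𝕜 : Type k) (A : Type u) (X : Type v)
    [RCLike 𝕜] [NormedRing A] [NormedAlgebra 𝕜 A] [NormedAddCommGroup X] [Module A X] :
    Submodule A X :=
  sInf {N : Submodule A X |
    ∃ (Y : Type v) (_ : NormedAddCommGroup Y) (_ : NormedSpace 𝕜 Y) (_ : CompleteSpace Y)
      (_ : Module A Y) (_ : IsScalarTower 𝕜 A Y) (_ : IsBoundedSMul A Y) (α : Y →L[A] X),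
      IsMaximalContractiveMono 𝕜 α ∧ N = LinearMap.range (α : Y →ₗ[A] X)}

/-- The union of the ranges of all small morphisms of Banach modules into `X`. -/
def smallUnion (𝕜 : Type k) (A : Type u) (X : Type v)
    [RCLike 𝕜] [NormedRing A] [NormedAlgebra 𝕜 A] [NormedAddCommGroup X] [Module A X] :
    Set X :=
  {x : X |
    ∃ (X₀ : Type v) (_ : NormedAddCommGroup X₀) (_ : NormedSpace 𝕜 X₀) (_ : CompleteSpace X₀)
      (_ : Module A X₀) (_ : IsScalarTower 𝕜 A X₀) (_ : IsBoundedSMul A X₀) (ψ : X₀ →L[A] X),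
      IsSmallMorphism.{v} 𝕜 ψ ∧ x ∈ Set.range ψ}

end

section BanachModule

variable {𝕜 : Type k} {A : Type u} {X : Type v}
  [RCLike 𝕜] [NormedRing A] [NormedAlgebra 𝕜 A]
  [NormedAddCommGroup X] [Module A X]

/-! For finitely generated `X` the topological radical is the algebraic Jacobson radical. The key is
`Submodule.eq_top_of_dense_of_finite`: generators can be approximated from a dense submodule, and a
small perturbation of a surjection `Aⁿ → X` stays surjective. So maximal submodules are closed,
hence Banach modules, and they are exactly the ranges of maximal contractive monomorphisms.
Smallness is then a Nakayama argument: a proper range lies in a maximal submodule, which absorbs the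
radical; conversely, a morphism not landing in some maximal `N` is complementary to the inclusion of
`N`, so it is not small. -/

theorem isContractiveMono_subtypeL (N : Submodule A X) : IsContractiveMono N.subtypeL :=
  ⟨N.injective_subtype, fun _ => le_rfl⟩

theorem surjective_subtypeL_iff {N : Submodule A X} : Surjective N.subtypeL ↔ N = ⊤ := by
  conv_rhs => rw [← N.range_subtype]
  exact LinearMap.range_eq_top.symm

/-- A morphism into a finitely generated module with range in the Jacobson radical is small. -/
theorem isSmallMorphism_of_range_le_jacobson [Module.Finite A X] {X₀ : Type t}
    [NormedAddCommGroup X₀] [Module A X₀] (ψ : X₀ →L[A] X)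
    (hψ : ∀ z, ψ z ∈ Module.jacobson A X) : IsSmallMorphism.{w} 𝕜 ψ := by
  intro Y _ _ _ _ _ _ φ h
  by_contra hφ
  -- Finite generation makes the lattice of submodules coatomic.
  obtain ⟨N, hN, hle⟩ := (eq_top_or_exists_le_coatom (LinearMap.range (φ : Y →ₗ[A] X))).resolve_left
    fun h => hφ (LinearMap.range_eq_top.1 h)
  refine hN.1 (eq_top_iff.2 fun x _ => ?_)
  obtain ⟨⟨y, z⟩, rfl⟩ := h x
  exact N.add_mem (hle (LinearMap.mem_range_self (φ : Y →ₗ[A] X) y))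
    ((sInf_le hN : Module.jacobson A X ≤ N) (hψ z))

/-- The inclusion of a maximal submodule is a maximal contractive monomorphism. -/
theorem IsCoatom.isMaximalContractiveMono_subtypeL {N : Submodule A X} (hN : IsCoatom N) :
    IsMaximalContractiveMono 𝕜 N.subtypeL := by
  refine ⟨isContractiveMono_subtypeL N, fun h => hN.1 (surjective_subtypeL_iff.1 h), ?_⟩
  intro Z _ _ _ _ _ _ β κ hβ hβs hκ h
  have hβκ (y : N) : β (κ y) = y := (DFunLike.congr_fun h y).symm
  have hle : N ≤ LinearMap.range (β : Z →ₗ[A] X) := fun y hy => ⟨κ ⟨y, hy⟩, hβκ ⟨y, hy⟩⟩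
  have hrange : LinearMap.range (β : Z →ₗ[A] X) = N :=
    (hN.le_iff.1 hle).resolve_left fun h => hβs (LinearMap.range_eq_top.1 h)
  refine ⟨AddMonoidHomClass.isometry_of_norm κ fun y => (hκ y).antisymm ?_, fun z => ?_⟩
  · calc ‖y‖ = ‖β (κ y)‖ := by rw [hβκ]; rfl
      _ ≤ ‖κ y‖ := hβ.2 _
  · have hz : β z ∈ N := hrange ▸ LinearMap.mem_range_self (β : Z →ₗ[A] X) z
    exact ⟨⟨β z, hz⟩, hβ.1 (hβκ _)⟩

variable [IsBoundedSMul A X]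

instance Submodule.instIsBoundedSMul (N : Submodule A X) : IsBoundedSMul A N :=
  .of_norm_smul_le fun a x => norm_smul_le a (x : X)

variable [NormedSpace 𝕜 X] [IsScalarTower 𝕜 A X]

/-- A dense submodule of a finitely generated Banach module is the whole module. -/
theorem Submodule.eq_top_of_dense_of_finite (𝕜 : Type k) [RCLike 𝕜] [NormedAlgebra 𝕜 A]
    [NormedSpace 𝕜 X] [IsScalarTower 𝕜 A X] [CompleteSpace A] [CompleteSpace X] [Module.Finite A X]
    (N : Submodule A X) (hN : Dense (N : Set X)) : N = ⊤ := by
  obtain ⟨n, x, hx⟩ := Module.Finite.exists_fin (R := A) (M := X)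
  -- `T y` sends the standard basis of `Aⁿ` to the tuple `y`; for generators it is onto, so the open
  -- mapping theorem gives a bounded, possibly nonlinear, right inverse `S`.
  let T : (Fin n → X) → (Fin n → A) →L[𝕜] X := fun y =>
    { toLinearMap := (Fintype.linearCombination A y).restrictScalars 𝕜
      cont := by
        change Continuous fun a : Fin n → A => Fintype.linearCombination A y a
        simp only [Fintype.linearCombination_apply]
        fun_prop }
  have T_apply (y : Fin n → X) (a : Fin n → A) : T y a = ∑ i, a i • y i := rfl
  have hT : (T x).range = ⊤ := by
    rw [LinearMap.range_eq_top]
    intro z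
    have hz : z ∈ Submodule.span A (Set.range x) := hx ▸ Submodule.mem_top
    rwa [← Fintype.range_linearCombination] at hz
  let S := (T x).nonlinearRightInverseOfSurjective hT
  have hS : 0 < S.nnnorm := (T x).nonlinearRightInverseOfSurjective_nnnorm_pos hT
  -- Moving each generator by less than `δ` moves `T x` by at most `n * δ` in the sup norm on `Aⁿ`;
  -- surjectivity survives below `S.nnnorm⁻¹`. Dividing by `n + 1` makes the bound strict and covers
  -- `n = 0`.
  obtain ⟨δ, hδ, hδS⟩ : ∃ δ : ℝ, 0 < δ ∧ n * δ < (S.nnnorm : ℝ)⁻¹ := by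
    have hS' : (0 : ℝ) < (S.nnnorm : ℝ)⁻¹ := by positivity
    refine ⟨(S.nnnorm : ℝ)⁻¹ / (n + 1), by positivity, ?_⟩
    rw [mul_div_assoc', div_lt_iff₀ (by positivity)]
    nlinarith
  choose y hyN hy using fun i => Metric.dense_iff.1 hN (x i) δ hδ
  have hnδ : 0 ≤ n * δ := by positivity
  have happ : ApproximatesLinearOn (T (fun i => y i)) (T x) Set.univ
      (Real.toNNReal (n * δ)) := by
    intro a _ b _
    rw [Real.coe_toNNReal _ hnδ, ← map_sub, T_apply, T_apply,
      ← Finset.sum_sub_distrib]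
    refine (norm_sum_le_of_le (n := fun _ => ‖a - b‖ * δ) _ fun i _ => ?_).trans_eq ?_
    · rw [← smul_sub]
      refine (norm_smul_le _ _).trans ?_
      gcongr
      · exact norm_le_pi_norm (a - b) i
      · exact (mem_ball_iff_norm.1 (hyN i)).le
    · simp only [Finset.sum_const, Finset.card_univ, Fintype.card_fin, nsmul_eq_mul]
      ring
  -- The image of the unit ball under the perturbed map contains a ball about `0`, and this image
  -- lies in `N`.
  have hsurj := happ.surjOn_closedBall_of_nonlinearRightInverse S (b := 0) zero_le_one
    (Set.subset_univ _)
  rw [Real.coe_toNNReal _ hnδ] at hsurj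
  set r : ℝ := ((S.nnnorm : ℝ)⁻¹ - n * δ) * 1 with hr
  have hr0 : 0 < r := by rw [hr]; linarith
  have hball : Metric.closedBall (0 : X) r ⊆ N := by
    intro z hz
    rw [← map_zero (T y)] at hz
    obtain ⟨a, -, rfl⟩ := hsurj hz
    rw [T_apply]
    exact N.sum_mem fun i _ => N.smul_mem (a i) (hy i)
  have htop : N.restrictScalars 𝕜 = ⊤ :=
    Submodule.eq_top_of_nonempty_interior' _
      ⟨0, mem_interior_iff_mem_nhds.2 (Filter.mem_of_superset (Metric.closedBall_mem_nhds _ hr0)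
        hball)⟩
  exact (Submodule.restrictScalars_eq_top_iff 𝕜 A X).1 htop

/-- The closure of a proper submodule of a finitely generated Banach module is proper. -/
theorem Submodule.topologicalClosure_ne_top_of_finite (𝕜 : Type k) [RCLike 𝕜] [NormedAlgebra 𝕜 A]
    [NormedSpace 𝕜 X] [IsScalarTower 𝕜 A X] [CompleteSpace A] [CompleteSpace X] [Module.Finite A X]
    {N : Submodule A X} (hN : N ≠ ⊤) : N.topologicalClosure ≠ ⊤ := fun h =>
  hN (N.eq_top_of_dense_of_finite 𝕜 (Submodule.dense_iff_topologicalClosure_eq_top.2 h))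

/-- A maximal submodule of a finitely generated Banach module is closed. -/
theorem IsCoatom.isClosed_of_finite (𝕜 : Type k) [RCLike 𝕜] [NormedAlgebra 𝕜 A]
    [NormedSpace 𝕜 X] [IsScalarTower 𝕜 A X] [CompleteSpace A] [CompleteSpace X] [Module.Finite A X]
    {N : Submodule A X} (hN : IsCoatom N) : IsClosed (N : Set X) := by
  have h := (hN.le_iff.1 N.le_topologicalClosure).resolve_left
    (Submodule.topologicalClosure_ne_top_of_finite 𝕜 hN.1)
  rw [← h]
  exact N.isClosed_topologicalClosure

/-- The range of a maximal contractive monomorphism into a finitely generated Banach module is a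
maximal submodule. -/
theorem IsMaximalContractiveMono.isCoatom_range [CompleteSpace A] [CompleteSpace X]
    [Module.Finite A X] {Y : Type v} [NormedAddCommGroup Y] [Module A Y] {α : Y →L[A] X}
    (hα : IsMaximalContractiveMono 𝕜 α) : IsCoatom (LinearMap.range (α : Y →ₗ[A] X)) := by
  refine ⟨fun h => hα.2.1 (LinearMap.range_eq_top.1 h), fun M hM => ?_⟩
  by_contra hMtop
  -- `M` need not be complete, but its closure is, and is still proper. Maximality of `α` tested
  -- against `Z` makes the range of `α` all of `Z`, hence contain `M`.
  let Z := M.topologicalClosure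
  have hZ : Z ≠ ⊤ := Submodule.topologicalClosure_ne_top_of_finite 𝕜 hMtop
  have : CompleteSpace Z := M.isClosed_topologicalClosure.completeSpace_coe
  have hmem (y : Y) : α y ∈ Z :=
    M.le_topologicalClosure (hM.le (LinearMap.mem_range_self (α : Y →ₗ[A] X) y))
  obtain ⟨-, hκ⟩ := hα.2.2 Z Z.subtypeL (α.codRestrict Z hmem) (isContractiveMono_subtypeL Z)
    (fun h => hZ (surjective_subtypeL_iff.1 h)) (fun y => hα.1.2 y) rfl
  refine hM.not_ge fun m hm => ?_
  obtain ⟨y, hy⟩ := hκ ⟨m, M.le_topologicalClosure hm⟩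
  exact ⟨y, congrArg Subtype.val hy⟩

/-- The topological radical of a finitely generated Banach module is its Jacobson radical. -/
theorem trad_eq_jacobson [CompleteSpace A] [CompleteSpace X] [Module.Finite A X] :
    trad 𝕜 A X = Module.jacobson A X := by
  refine congrArg sInf (Set.ext fun N => ⟨?_, fun hN => ?_⟩)
  · rintro ⟨Y, _, _, _, _, _, _, α, hα, rfl⟩
    exact hα.isCoatom_range
  · have hN' : IsCoatom N := hN
    have : CompleteSpace N := (hN'.isClosed_of_finite 𝕜).completeSpace_coe
    exact ⟨N, _, inferInstance, inferInstance, _, inferInstance, inferInstance, N.subtypeL,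
      hN'.isMaximalContractiveMono_subtypeL, N.range_subtype.symm⟩

theorem Module.isClosed_jacobson_of_finite (𝕜 : Type k) [RCLike 𝕜] [NormedAlgebra 𝕜 A]
    [NormedSpace 𝕜 X] [IsScalarTower 𝕜 A X] [CompleteSpace A] [CompleteSpace X]
    [Module.Finite A X] : IsClosed (Module.jacobson A X : Set X) := by
  rw [Module.jacobson, Submodule.coe_sInf]
  exact isClosed_biInter fun N hN => IsCoatom.isClosed_of_finite 𝕜 hN

/-- The range of a small morphism is contained in every closed maximal submodule. -/
theorem IsSmallMorphism.apply_mem_of_isCoatom [CompleteSpace X] {X₀ : Type t}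
    [NormedAddCommGroup X₀] [Module A X₀] {ψ : X₀ →L[A] X} (hψ : IsSmallMorphism.{v} 𝕜 ψ)
    {N : Submodule A X} (hN : IsCoatom N) (hNc : IsClosed (N : Set X)) (z : X₀) : ψ z ∈ N := by
  by_contra hz
  have : CompleteSpace N := hNc.completeSpace_coe
  have hsup : N ⊔ LinearMap.range (ψ : X₀ →ₗ[A] X) = ⊤ :=
    hN.2 _ (left_lt_sup.2 fun h => hz (h (LinearMap.mem_range_self (ψ : X₀ →ₗ[A] X) z)))
  refine hN.1 (surjective_subtypeL_iff.1 (hψ N N.subtypeL fun x => ?_))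
  obtain ⟨y, hy, _, ⟨z, rfl⟩, h⟩ := Submodule.mem_sup.1 (hsup ▸ Submodule.mem_top : x ∈ _)
  exact ⟨(⟨y, hy⟩, z), h⟩

end BanachModule

theorem mainTheorem11 {𝕜 : Type k} {A : Type u} {X : Type v}
    [RCLike 𝕜] [NormedRing A] [NormedAlgebra 𝕜 A] [CompleteSpace A]
    [NormedAddCommGroup X] [NormedSpace 𝕜 X] [CompleteSpace X]
    [Module A X] [IsScalarTower 𝕜 A X] [IsBoundedSMul A X] [Module.Finite A X] :
    IsClosed (trad 𝕜 A X : Set X) ∧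
      (trad 𝕜 A X : Set X) = smallUnion 𝕜 A X ∧
      IsSmallMorphism.{w} 𝕜 (trad 𝕜 A X).subtypeL := by
  rw [trad_eq_jacobson]
  have hclosed : IsClosed (Module.jacobson A X : Set X) := Module.isClosed_jacobson_of_finite 𝕜
  refine ⟨hclosed, Set.Subset.antisymm (fun x hx => ?_) ?_,
    isSmallMorphism_of_range_le_jacobson _ fun z => z.2⟩
  · have : CompleteSpace (Module.jacobson A X) := hclosed.completeSpace_coe
    exact ⟨Module.jacobson A X, _, inferInstance, inferInstance, _, inferInstance, inferInstance,
      (Module.jacobson A X).subtypeL, isSmallMorphism_of_range_le_jacobson _ fun z => z.2,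
      ⟨x, hx⟩, rfl⟩
  · rintro _ ⟨X₀, _, _, _, _, _, _, ψ, hψ, z, rfl⟩
    exact Submodule.mem_sInf.2 fun N hN =>
      hψ.apply_mem_of_isCoatom hN (IsCoatom.isClosed_of_finite 𝕜 hN) z
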